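/- Let $\ell^2=\ell^2(\mathbb N_0)$ be the complex Hilbert space of square summable sequences (with inner product linear in the second argument), let $\delta_0=(1,0,0,\dots)$, and for a sequence $u=(u_n)_{n\ge 0}$ put $$(\tau u)_0=u_0+u_1,\qquad (\tau u)_n=n\,u_{n-1}+(2n+1)\,u_n+(n+1)\,u_{n+1}\quad(n\ge 1).$$ Let $H_0$ be the maximal Laguerre Jacobi operator, $H_0u=\tau u$ with domain $\mathcal D_{\max}=\{u\in\ell^2:\tau u\in\ell^2\}$. Let $d\rho(\lambda)=\mathbb 1_{[0,\infty)}(\lambda)e^{-\lambda}d\lambda$ on $\mathbb R$, and let $E_1(z)=\int_z^{\infty}\frac{e^{-w}}{w}\,dw$, $z\in\mathbb C\setminus(-\infty,0]$, be the principal value of the exponential integral (with the path of integration avoiding $(-\infty,0]$, for instance $w=z+t$, $t\ge0$). **Theorem 2.1.** (i) $H_0$ is self-adjoint and positive: $\langle u,H_0u\rangle>0$ for all $0\neq u\in\mathcal D_{\max}$. (ii) The Weyl function $m_0(z)=\langle\delta_0,(H_0-z)^{-1}\delta_0\rangle$ is given by $$m_0(z)=e^{-z}E_1(-z)=\int_0^{+\infty}\frac{e^{-\lambda}}{\lambda-z}\,d\lambda,\qquad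 z\in\mathbb C\setminus[0,\infty),$$ and the integral converges absolutely. The spectral measure of $H_0$ is $\rho$: the operator $H_0$ has a spectral resolution $H_0=\int\lambda\,dE(\lambda)$ with a projection-valued measure $E$ on $\mathbb R$ such that $\langle\delta_0,E(B)\delta_0\rangle=\rho(B)$ for all Borel sets $B\subseteq\mathbb R$; moreover, some unitary map $U:\ell^2\to L^2(\mathbb R,d\rho)$ with $U\delta_0=1$ transforms $H_0$ into the maximal operator of multiplication by $\lambda$ in $L^2(\mathbb R,d\rho)$. (iii) The spectrum of $H_0$ is purely absolutely continuous, that is, for every $u\in\ell^2$ the measure $B\mapsto\langle u,E(B)u\rangle$ is absolutely continuous with respect to Lebesgue measure, and it is equal to $[0,\infty)$. -/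

import Mathlib

open MeasureTheory

noncomputable section

namespace LaguerreJacobi

/-! ### Unbounded operators: positivity, resolvent, spectrum -/

section Operators

variable {H : Type*} [NormedAddCommGroup H] [InnerProductSpace ℂ H]

/-- Positivity of an operator: `⟨u, A u⟩` is real and strictly positive for every nonzero `u` in
the domain of `A`. -/
def IsPositiveOperator (A : H →ₗ.[ℂ] H) : Prop :=
  ∀ u : A.domain, u ≠ 0 → (inner ℂ (u : H) (A u)).im = 0 ∧ 0 < (inner ℂ (u : H) (A u)).re

/-- The bounded operator `R` is the two-sided inverse of `A - z : dom A → H`. -/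
def IsResolventAt (A : H →ₗ.[ℂ] H) (z : ℂ) (R : H →L[ℂ] H) : Prop :=
  (∀ v : H, ∃ h : R v ∈ A.domain, A ⟨R v, h⟩ - z • R v = v) ∧
    ∀ u : A.domain, R (A u - z • (u : H)) = u

/-- The set of all `z` such that `A - z : dom A → H` has a bounded everywhere defined inverse. -/
def resolventSet (A : H →ₗ.[ℂ] H) : Set ℂ :=
  {z | ∃ R : H →L[ℂ] H, IsResolventAt A z R}

/-- The spectrum of an (unbounded) operator. -/
def spectrum (A : H →ₗ.[ℂ] H) : Set ℂ :=
  (resolventSet A)ᶜ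

open Classical in
/-- The resolvent `(A - z)⁻¹`; it is given the value `0` if `z` lies in the spectrum. -/
def resolvent (A : H →ₗ.[ℂ] H) (z : ℂ) : H →L[ℂ] H :=
  if h : ∃ R : H →L[ℂ] H, IsResolventAt A z R then h.choose else 0

end Operators

/-! ### Projection-valued measures -/

/-- A projection-valued measure on the Borel sets of `ℝ`: every value is an orthogonal projection,
the whole line is mapped to the identity, and the measure is countably additive in the strong
operator topology. On non-measurable sets it takes the value `0` by convention. -/
structure ProjectionValuedMeasure (H : Type*) [NormedAddCommGroup H] [InnerProductSpace ℂ H]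
    [CompleteSpace H] where
  proj : Set ℝ → (H →L[ℂ] H)
  isStarProjection : ∀ B, MeasurableSet B → IsStarProjection (proj B)
  proj_univ : proj Set.univ = 1
  hasSum_proj : ∀ B : ℕ → Set ℝ, (∀ n, MeasurableSet (B n)) → Pairwise (Function.onFun Disjoint B) →
    ∀ u : H, HasSum (fun n => proj (B n) u) (proj (⋃ n, B n) u)
  proj_of_not_measurable : ∀ B, ¬ MeasurableSet B → proj B = 0

namespace ProjectionValuedMeasure

variable {H : Type*} [NormedAddCommGroup H] [InnerProductSpace ℂ H] [CompleteSpace H]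

theorem inner_proj_nonneg (E : ProjectionValuedMeasure H) {B : Set ℝ} (hB : MeasurableSet B)
    (u : H) : 0 ≤ (inner ℂ u (E.proj B u)).re := by
  have h := E.isStarProjection B hB
  have h1 : E.proj B (E.proj B u) = E.proj B u := by
    have := congrArg (fun T : H →L[ℂ] H => T u) h.isIdempotentElem.eq
    simpa using this
  have h2 : inner ℂ u (E.proj B u) = inner ℂ (E.proj B u) (E.proj B u) := by
    conv_lhs => rw [← h1]
    rw [← ContinuousLinearMap.adjoint_inner_left, ← ContinuousLinearMap.star_eq_adjoint,
      h.isSelfAdjoint.star_eq]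
  rw [h2]
  exact inner_self_nonneg (𝕜 := ℂ)

theorem proj_empty (E : ProjectionValuedMeasure H) : E.proj ∅ = 0 := by
  ext u
  have h := E.hasSum_proj (fun _ => ∅) (fun _ => MeasurableSet.empty)
    (fun _ _ _ => by simp [Function.onFun]) u
  simpa using (tendsto_nhds_unique h.summable.tendsto_atTop_zero tendsto_const_nhds).symm

/-- The scalar spectral measure `B ↦ ⟨u, E(B) u⟩` of the vector `u`. -/
def scalarMeasure (E : ProjectionValuedMeasure H) (u : H) : Measure ℝ :=
  Measure.ofMeasurable (fun B _ => ENNReal.ofReal (inner ℂ u (E.proj B u)).re)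
    (by simp [E.proj_empty])
    (by
      intro B hB hd
      have h := E.hasSum_proj B hB hd u
      have h2 : HasSum (fun n => (inner ℂ u (E.proj (B n) u)).re)
          (inner ℂ u (E.proj (⋃ n, B n) u)).re :=
        Complex.reCLM.hasSum ((innerSL ℂ u).hasSum h)
      rw [← h2.tsum_eq]
      exact ENNReal.ofReal_tsum_of_nonneg (fun n => E.inner_proj_nonneg (hB n) u) h2.summable)

/-- `E` is a spectral resolution of the operator `A`, that is, `A = ∫ x dE(x)`: the domain of `A`
consists of all `u` with `∫ x² d⟨u, E u⟩ < ∞`, and `⟨u, A u⟩ = ∫ x d⟨u, E u⟩` for all such `u`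
(which determines `A` by polarization). -/
def IsResolutionOf (E : ProjectionValuedMeasure H) (A : H →ₗ.[ℂ] H) : Prop :=
  (∀ u : H, u ∈ A.domain ↔ Integrable (fun x : ℝ => x ^ 2) (E.scalarMeasure u)) ∧
    ∀ u : A.domain, inner ℂ (u : H) (A u) = ((∫ x : ℝ, x ∂(E.scalarMeasure (u : H)) : ℝ) : ℂ)

end ProjectionValuedMeasure

/-- The unitary map `U` turns `A` into the maximal operator of multiplication by the independent
variable in `L²(ρ)`, and it maps the vector `φ` to the constant function `1`. -/
def IsSpectralTransform {H : Type*} [NormedAddCommGroup H] [InnerProductSpace ℂ H]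
    (A : H →ₗ.[ℂ] H) (φ : H) (ρ : Measure ℝ) (U : H ≃ₗᵢ[ℂ] Lp ℂ 2 ρ) : Prop :=
  (∀ᵐ x ∂ρ, U φ x = 1) ∧
    (∀ u : H, u ∈ A.domain ↔ MemLp (fun x : ℝ => (x : ℂ) * U u x) 2 ρ) ∧
    ∀ u : A.domain, ∀ᵐ x ∂ρ, U (A u) x = (x : ℂ) * U (u : H) x

/-! ### The Laguerre Jacobi operator -/

/-- The Hilbert space of square summable complex sequences `(u₀, u₁, …)`. -/
abbrev ℓ2 : Type := lp (fun _ : ℕ => ℂ) 2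

/-- The difference expression given by the Jacobi matrix with diagonal entries `2n + 1` and
off-diagonal entries `n + 1`. -/
def tau (u : ℕ → ℂ) : ℕ → ℂ
  | 0 => u 0 + u 1
  | n + 1 => ((n : ℂ) + 1) * u n + (2 * ((n : ℂ) + 1) + 1) * u (n + 1)
      + (((n : ℂ) + 1) + 1) * u (n + 2)

theorem tau_add (u v : ℕ → ℂ) : tau (u + v) = tau u + tau v := by
  funext n
  cases n <;> simp only [tau, Pi.add_apply] <;> ring

theorem tau_smul (c : ℂ) (u : ℕ → ℂ) : tau (c • u) = c • tau u := by
  funext n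
  cases n <;> simp only [tau, Pi.smul_apply, smul_eq_mul] <;> ring

/-- The maximal domain: all `u ∈ ℓ²` with `τ u ∈ ℓ²`. -/
def maximalDomain : Submodule ℂ ℓ2 where
  carrier := {u | Memℓp (tau u) 2}
  zero_mem' := by
    have h : tau ((0 : ℓ2) : ℕ → ℂ) = 0 := by
      funext n
      cases n <;> simp [tau]
    simp only [Set.mem_ofPred_eq, h]
    exact zero_memℓp
  add_mem' {u v} hu hv := by
    simp only [Set.mem_ofPred_eq, lp.coeFn_add, tau_add] at *
    exact hu.add hv
  smul_mem' c u hu := by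
    simp only [Set.mem_ofPred_eq, lp.coeFn_smul, tau_smul] at *
    exact hu.const_smul c

/-- The maximal Laguerre Jacobi operator `H₀ u = τ u` on the maximal domain. -/
def H0 : ℓ2 →ₗ.[ℂ] ℓ2 where
  domain := maximalDomain
  toFun :=
    { toFun := fun u => ⟨tau (u : ℓ2), u.2⟩
      map_add' := fun u v => by
        ext n
        exact congrFun (tau_add (u : ℓ2) (v : ℓ2)) n
      map_smul' := fun c u => by
        ext n
        exact congrFun (tau_smul c (u : ℓ2)) n }

/-- The first unit vector `(1, 0, 0, …)`. -/
def delta0 : ℓ2 := lp.single 2 0 (1 : ℂ)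

/-- The Weyl function `m₀(z) = ⟨δ₀, (H₀ - z)⁻¹ δ₀⟩` (the inner product is linear in the second
argument). -/
def weylFunction (z : ℂ) : ℂ :=
  inner ℂ delta0 (resolvent H0 z delta0)

/-- The measure `1_{[0,∞)}(x) e^{-x} dx` on the real line. -/
def expMeasure : Measure ℝ :=
  volume.withDensity fun x => ENNReal.ofReal ((Set.Ici (0 : ℝ)).indicator (fun y => Real.exp (-y)) x)

/-- The principal value of the exponential integral `E₁(z) = ∫_z^∞ e^{-w} / w dw` for
`z ∉ (-∞, 0]`, along the path `w = z + t`, `t ≥ 0`, which does not meet `(-∞, 0]`. -/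
def expIntegralE1 (z : ℂ) : ℂ :=
  ∫ t in Set.Ioi (0 : ℝ), Complex.exp (-(z + t)) / (z + t)

end LaguerreJacobi

end

noncomputable section

namespace LaguerreJacobi

/-! The entries of the Jacobi matrix are the recurrence coefficients of the polynomials `(-1)ⁿ Lₙ`,
which are orthonormal for `e^{-x} dx` on the half-line. If they form a basis, then `δₙ ↦ (-1)ⁿ Lₙ`
defines a unitary map `U` of `ℓ²` onto `L²(ρ)`, and by the recurrence `τ` becomes multiplication by
`x`.

Completeness and the identification of the domain rest on one fact: a density with an integrable
exponential weight is determined by its moments (`ae_eq_zero_of_moments`). Its positive and negative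
parts give measures whose moment generating functions are analytic in a strip around the imaginary
axis, with the moments as derivatives at `0`.

The fact covers more than `L²`. For any `u` in `ℓ²` the function `x · Uu` may leave `L²(ρ)`, but it
keeps some exponential decay and has Laguerre coefficients `τ u`. So `τ u ∈ ℓ²` forces `x · Uu ∈
L²(ρ)`: the maximal domain is exactly that of multiplication by `x` (`mem_domain_H0_iff`).

The rest is read off in `L²(ρ)`: projections are restrictions to Borel sets, the measure of `u` has
density `|Uu|²` against `ρ`, and the resolvent is multiplication by `(x - z)⁻¹`, whose matrix
element at `1` is the Weyl function. Indicators of short intervals are approximate eigenvectors and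
fill the spectrum. -/

/-! ### The exponential weight and its moments -/

theorem expMeasure_eq : expMeasure =
    (volume.restrict (Set.Ioi (0 : ℝ))).withDensity fun x => ENNReal.ofReal (Real.exp (-x)) := by
  rw [expMeasure, restrict_Ioi_eq_restrict_Ici, ← withDensity_indicator measurableSet_Ici]
  congr 1
  funext x
  by_cases h : x ∈ Set.Ici (0 : ℝ) <;> simp [h]

theorem integrable_expMeasure_iff {F : Type*} [NormedAddCommGroup F] [NormedSpace ℝ F]
    {f : ℝ → F} :
    Integrable f expMeasure ↔ IntegrableOn (fun x => Real.exp (-x) • f x) (Set.Ioi 0) := by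
  rw [expMeasure_eq, integrable_withDensity_iff_integrable_smul' (by fun_prop) (by simp)]
  simp [IntegrableOn, ENNReal.toReal_ofReal (Real.exp_nonneg _)]

theorem integral_expMeasure {F : Type*} [NormedAddCommGroup F] [NormedSpace ℝ F] (f : ℝ → F) :
    ∫ x, f x ∂expMeasure = ∫ x in Set.Ioi 0, Real.exp (-x) • f x := by
  rw [expMeasure_eq, integral_withDensity_eq_integral_toReal_smul (by fun_prop) (by simp)]
  simp [ENNReal.toReal_ofReal (Real.exp_nonneg _)]

theorem integrable_exp_mul_expMeasure {t : ℝ} (ht : t < 1) :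
    Integrable (fun x : ℝ => Real.exp (t * x)) expMeasure := by
  rw [integrable_expMeasure_iff]
  have h := exp_neg_integrableOn_Ioi 0 (sub_pos.2 ht)
  refine h.congr_fun (fun x _ => ?_) measurableSet_Ioi
  simp only [smul_eq_mul, ← Real.exp_add]
  congr 1
  ring

instance : IsFiniteMeasure expMeasure := by
  have h := integrable_exp_mul_expMeasure zero_lt_one
  simp only [zero_mul, Real.exp_zero] at h
  simpa [integrable_const_iff] using h

theorem expMeasure_absolutelyContinuous : expMeasure.AbsolutelyContinuous volume :=
  withDensity_absolutelyContinuous _ _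

theorem ae_expMeasure_pos : ∀ᵐ x ∂expMeasure, 0 < x := by
  rw [expMeasure_eq]
  exact (withDensity_absolutelyContinuous _ _).ae_le (ae_restrict_mem measurableSet_Ioi)

theorem integral_pow_expMeasure (n : ℕ) : ∫ x, x ^ n ∂expMeasure = (n.factorial : ℝ) := by
  rw [integral_expMeasure, ← Real.Gamma_nat_eq_factorial, Real.Gamma_eq_integral (by positivity)]
  simp

theorem memLp_exp_abs_expMeasure {t : ℝ} (ht : t < 1 / 2) :
    MemLp (fun x : ℝ => Real.exp (t * |x|)) 2 expMeasure := by
  rw [memLp_two_iff_integrable_sq (by fun_prop)]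
  have h := integrable_exp_mul_expMeasure (t := 2 * t) (by linarith)
  refine h.congr ?_
  filter_upwards [ae_expMeasure_pos] with x hx
  rw [abs_of_pos hx, ← Real.exp_nat_mul]
  congr 1
  push_cast
  ring

/-! ### Determinacy of moments under exponential decay -/

section Moments

open ProbabilityTheory Filter Topology

/-- Two finite measures on the line with some finite exponential moments are equal as soon as
all their moments are equal. -/
theorem measure_ext_of_moments {μ ν : Measure ℝ} [IsFiniteMeasure μ] [IsFiniteMeasure ν] {a : ℝ}
    (ha : 0 < a)
    (hμ : ∀ t, |t| < a → Integrable (fun x => Real.exp (t * x)) μ)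
    (hν : ∀ t, |t| < a → Integrable (fun x => Real.exp (t * x)) ν)
    (h : ∀ n : ℕ, ∫ x, x ^ n ∂μ = ∫ x, x ^ n ∂ν) : μ = ν := by
  have key : ∀ {κ : Measure ℝ}, (∀ t, |t| < a → Integrable (fun x => Real.exp (t * x)) κ) →
      Set.Ioo (-a) a ⊆ interior (integrableExpSet id κ) := fun hκ =>
    interior_maximal (fun t ht => hκ t (abs_lt.2 ht)) isOpen_Ioo
  have hS : IsPreconnected {z : ℂ | z.re ∈ Set.Ioo (-a) a} :=
    ((convex_Ioo (-a) a).linear_preimage Complex.reLm).isPreconnected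
  have h0 : (0 : ℝ) ∈ Set.Ioo (-a) a := by simp [ha]
  have hA : ∀ {κ : Measure ℝ}, (∀ t, |t| < a → Integrable (fun x => Real.exp (t * x)) κ) →
      AnalyticOnNhd ℂ (complexMGF id κ) {z : ℂ | z.re ∈ Set.Ioo (-a) a} := fun hκ =>
    analyticOnNhd_complexMGF.mono fun z hz => key hκ hz
  have hP : ∀ {κ : Measure ℝ}, (∀ t, |t| < a → Integrable (fun x => Real.exp (t * x)) κ) →
      ∀ n, iteratedDeriv n (complexMGF id κ) 0 = ((∫ x, x ^ n ∂κ : ℝ) : ℂ) := fun {κ} hκ n => by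
    rw [iteratedDeriv_complexMGF (key hκ h0) n, ← integral_complex_ofReal]
    simp
  -- The derivatives at `0` are the moments, so both functions have the same Taylor series there;
  -- the identity theorem extends the equality to the whole strip.
  have hev : complexMGF id μ =ᶠ[𝓝 0] complexMGF id ν := by
    have h1 := (hA hμ 0 h0).hasFPowerSeriesAt
    have h2 := (hA hν 0 h0).hasFPowerSeriesAt
    simp only [hP hμ, hP hν, h] at h1 h2
    filter_upwards [h1.eventually_hasSum_sub, h2.eventually_hasSum_sub] with z hz1 hz2
    exact hz1.unique hz2
  have hEq := (hA hμ).eqOn_of_preconnected_of_eventuallyEq (hA hν) hS h0 hev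
  -- The strip contains the imaginary axis, where these functions are the characteristic functions.
  refine Measure.ext_of_charFun (funext fun t => ?_)
  rw [← complexMGF_id_mul_I, ← complexMGF_id_mul_I]
  exact hEq (by simp [ha])

theorem abs_pow_mul_exp_le {a : ℝ} (ha : 0 < a) (n : ℕ) :
    ∃ C : ℝ, 0 ≤ C ∧ ∀ x : ℝ, |x| ^ n ≤ C * Real.exp (a * |x|) := by
  -- One term of the exponential series: `(a|x|)ⁿ / n! ≤ e^{a|x|}`.
  refine ⟨n.factorial / a ^ n, by positivity, fun x => ?_⟩
  have h := Real.pow_div_factorial_le_exp (a * |x|) (by positivity) n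
  rw [div_le_iff₀ (by positivity), mul_pow] at h
  rw [div_mul_eq_mul_div, le_div_iff₀ (by positivity)]
  linarith

theorem integrable_pow_mul {F : Type*} [NormedAddCommGroup F] [NormedSpace ℝ F] {ρ : Measure ℝ}
    {g : ℝ → F} {a : ℝ} (ha : 0 < a) (hm : AEStronglyMeasurable g ρ)
    (hg : Integrable (fun x => Real.exp (a * |x|) • g x) ρ) (n : ℕ) :
    Integrable (fun x => x ^ n • g x) ρ := by
  obtain ⟨C, hC, hle⟩ := abs_pow_mul_exp_le ha n
  refine (hg.norm.const_mul C).mono' (by fun_prop) (ae_of_all _ fun x => ?_)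
  rw [norm_smul, norm_smul, norm_pow, Real.norm_eq_abs, Real.norm_eq_abs, Real.abs_exp, ← mul_assoc]
  exact mul_le_mul_of_nonneg_right (hle x) (norm_nonneg _)

/-- A real density with exponential decay all of whose moments vanish is zero. -/
theorem ae_eq_zero_of_moments_real {ρ : Measure ℝ} {g : ℝ → ℝ} {a : ℝ} (ha : 0 < a)
    (hm : AEStronglyMeasurable g ρ)
    (hg : Integrable (fun x => Real.exp (a * |x|) • g x) ρ)
    (h : ∀ n : ℕ, ∫ x, x ^ n • g x ∂ρ = 0) : g =ᵐ[ρ] 0 := by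
  have hgi : Integrable g ρ := by simpa using integrable_pow_mul ha hm hg 0
  have hfin : ∀ {k : ℝ → ℝ}, Integrable k ρ →
      IsFiniteMeasure (ρ.withDensity fun x => ENNReal.ofReal (k x)) := fun hk =>
    isFiniteMeasure_withDensity_ofReal hk.2
  have := hfin hgi
  have := hfin hgi.neg
  have hint : ∀ {k : ℝ → ℝ} (w : ℝ → ℝ), AEStronglyMeasurable k ρ →
      (Integrable w (ρ.withDensity fun x => ENNReal.ofReal (k x)) ↔
        Integrable (fun x => max (k x) 0 * w x) ρ) := fun {k} w hk => by
    rw [integrable_withDensity_iff_integrable_smul₀' (by fun_prop) (by simp)]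
    simp [ENNReal.toReal_ofReal']
  have hval : ∀ {k : ℝ → ℝ} (w : ℝ → ℝ), AEStronglyMeasurable k ρ →
      ∫ x, w x ∂(ρ.withDensity fun x => ENNReal.ofReal (k x)) =
        ∫ x, max (k x) 0 * w x ∂ρ := fun {k} w hk => by
    rw [integral_withDensity_eq_integral_toReal_smul₀ (by fun_prop) (by simp)]
    simp [ENNReal.toReal_ofReal']
  -- Phrased with `|k| = |g|` so as to serve both `k = g` and `k = -g`, that is, the positive and
  -- the negative part of `g`.
  have hexp : ∀ {k : ℝ → ℝ}, AEStronglyMeasurable k ρ → (∀ x, |k x| = |g x|) → ∀ t, |t| < a →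
      Integrable (fun x => Real.exp (t * x)) (ρ.withDensity fun x => ENNReal.ofReal (k x)) := by
    intro k hk hkg t ht
    rw [hint _ hk]
    refine hg.mono (by fun_prop) (ae_of_all _ fun x => ?_)
    simp only [smul_eq_mul, norm_mul, Real.norm_eq_abs, Real.abs_exp, ← hkg]
    rw [mul_comm]
    refine mul_le_mul (Real.exp_le_exp.2 ?_) ?_ (abs_nonneg _) (Real.exp_nonneg _)
    · calc t * x ≤ |t * x| := le_abs_self _
        _ = |t| * |x| := abs_mul _ _
        _ ≤ a * |x| := mul_le_mul_of_nonneg_right ht.le (abs_nonneg _)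
    · rw [abs_of_nonneg (le_max_right _ _)]
      exact max_le (le_abs_self _) (abs_nonneg _)
  have hpow : ∀ {k : ℝ → ℝ}, AEStronglyMeasurable k ρ → (∀ x, |k x| = |g x|) → ∀ n : ℕ,
      Integrable (fun x => max (k x) 0 * x ^ n) ρ := by
    intro k hk hkg n
    refine (integrable_pow_mul ha hm hg n).mono (by fun_prop) (ae_of_all _ fun x => ?_)
    simp only [smul_eq_mul, norm_mul, Real.norm_eq_abs, ← hkg]
    rw [mul_comm]
    refine mul_le_mul_of_nonneg_left ?_ (abs_nonneg _)
    rw [abs_of_nonneg (le_max_right _ _)]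
    exact max_le (le_abs_self _) (abs_nonneg _)
  have heq : (ρ.withDensity fun x => ENNReal.ofReal (g x)) =
      ρ.withDensity fun x => ENNReal.ofReal ((-g) x) := by
    refine measure_ext_of_moments ha (hexp hm fun _ => rfl)
      (hexp hm.neg fun x => by simp) fun n => ?_
    rw [hval _ hm, hval _ hm.neg, ← sub_eq_zero,
      ← integral_sub (hpow hm (fun _ => rfl) n) (hpow hm.neg (fun x => by simp) n)]
    refine (integral_congr_ae (ae_of_all _ fun x => ?_)).trans (h n)
    simp only [Pi.neg_apply, smul_eq_mul, ← sub_mul]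
    rw [mul_comm (x ^ n)]
    congr 1
    rcases le_total (g x) 0 with hx | hx
    · rw [max_eq_right hx, max_eq_left (by linarith)]; ring
    · rw [max_eq_left hx, max_eq_right (by linarith)]; ring
  have hne := withDensity_eq_iff (μ := ρ) hgi.1.aemeasurable.ennreal_ofReal
    hgi.neg.1.aemeasurable.ennreal_ofReal hgi.lintegral_lt_top.ne
  -- The two parts of `g x` coincide, and one of them is always zero; hence so is the other.
  filter_upwards [hne.1 heq] with x hx
  simp only [Pi.neg_apply] at hx
  rcases le_total (g x) 0 with hx0 | hx0
  · rw [ENNReal.ofReal_of_nonpos hx0, eq_comm, ENNReal.ofReal_eq_zero] at hx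
    simp; linarith
  · rw [ENNReal.ofReal_of_nonpos (p := -g x) (by linarith), ENNReal.ofReal_eq_zero] at hx
    simp; linarith

/-- A complex density with exponential decay all of whose moments vanish is zero. -/
theorem ae_eq_zero_of_moments {ρ : Measure ℝ} {g : ℝ → ℂ} {a : ℝ} (ha : 0 < a)
    (hm : AEStronglyMeasurable g ρ)
    (hg : Integrable (fun x => Real.exp (a * |x|) • g x) ρ)
    (h : ∀ n : ℕ, ∫ x, x ^ n • g x ∂ρ = 0) : g =ᵐ[ρ] 0 := by
  have hre : (fun x => (g x).re) =ᵐ[ρ] 0 := by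
    refine ae_eq_zero_of_moments_real ha (Complex.continuous_re.comp_aestronglyMeasurable hm) ?_ ?_
    · simpa only [RCLike.re_eq_complex_re, Complex.smul_re] using hg.re
    · intro n
      have h1 := integral_re (𝕜 := ℂ) (integrable_pow_mul ha hm hg n)
      rw [h n] at h1
      simpa only [RCLike.re_eq_complex_re, Complex.smul_re, Complex.zero_re] using h1
  have him : (fun x => (g x).im) =ᵐ[ρ] 0 := by
    refine ae_eq_zero_of_moments_real ha (Complex.continuous_im.comp_aestronglyMeasurable hm) ?_ ?_
    · simpa only [RCLike.im_eq_complex_im, Complex.smul_im] using hg.im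
    · intro n
      have h1 := integral_im (𝕜 := ℂ) (integrable_pow_mul ha hm hg n)
      rw [h n] at h1
      simpa only [RCLike.im_eq_complex_im, Complex.smul_im, Complex.zero_im] using h1
  filter_upwards [hre, him] with x h1 h2
  exact Complex.ext h1 h2

end Moments

/-! ### Laguerre polynomials: recurrence, orthonormality, completeness -/

/-- The coefficients of the sign-normalized Laguerre polynomials. -/
def laguerreCoeff (n k : ℕ) : ℝ := (-1) ^ (n + k) * (n.choose k : ℝ) / (k.factorial : ℝ)

/-- The sign-normalized Laguerre polynomials `(-1)ⁿ Lₙ`. -/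
def laguerre (n : ℕ) (x : ℝ) : ℝ := ∑ k ∈ Finset.range (n + 1), laguerreCoeff n k * x ^ k

/-- Superfluous binomials vanish; this lets polynomials of different degrees be summed over a common
range. -/
theorem laguerre_eq_sum {n N : ℕ} (h : n < N) (x : ℝ) :
    laguerre n x = ∑ k ∈ Finset.range N, laguerreCoeff n k * x ^ k := by
  refine Finset.sum_subset (by simpa using h) fun k _ hk => ?_
  rw [laguerreCoeff, Nat.choose_eq_zero_of_lt (by simpa using hk)]
  simp

@[simp]
theorem laguerre_zero (x : ℝ) : laguerre 0 x = 1 := by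
  simp [laguerre, laguerreCoeff]

theorem laguerre_one (x : ℝ) : laguerre 1 x = x - 1 := by
  simp [laguerre, laguerreCoeff, Finset.sum_range_succ]
  ring

/-- The coefficient of `x ^ (k + 1)` in the three-term recurrence. It reduces to Pascal's rule and
the absorption identity, each used at two consecutive rows. -/
theorem laguerreCoeff_succ (n k : ℕ) :
    ((n : ℝ) + 1) * laguerreCoeff n (k + 1) + (2 * ((n : ℝ) + 1) + 1) * laguerreCoeff (n + 1) (k + 1)
      + (((n : ℝ) + 1) + 1) * laguerreCoeff (n + 2) (k + 1) = laguerreCoeff (n + 1) k := by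
  have h1 : ((n + 2).choose (k + 1) : ℝ) = (n + 1).choose k + (n + 1).choose (k + 1) := by
    exact_mod_cast Nat.choose_succ_succ (n + 1) k
  have h2 : ((n + 1).choose (k + 1) : ℝ) = n.choose k + n.choose (k + 1) := by
    exact_mod_cast Nat.choose_succ_succ n k
  have h3 : ((n : ℝ) + 2) * (n + 1).choose k = (n + 2).choose (k + 1) * (k + 1) := by
    exact_mod_cast Nat.add_one_mul_choose_eq (n + 1) k
  have h4 : ((n : ℝ) + 1) * n.choose k = (n + 1).choose (k + 1) * (k + 1) := by
    exact_mod_cast Nat.add_one_mul_choose_eq n k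
  have hf : ((k.factorial : ℕ) : ℝ) ≠ 0 := by positivity
  simp only [laguerreCoeff, Nat.factorial_succ, Nat.cast_mul, Nat.cast_add, Nat.cast_one, pow_add,
    pow_one]
  field_simp
  linear_combination (-(n + 2 : ℝ)) * h1 + (n + 1 : ℝ) * h2 - h3 + h4 - ((k : ℝ) + 1) * h1

/-- The truncated index `n - 1` is harmless at `n = 0`, where its factor vanishes. -/
theorem laguerre_recurrence (n : ℕ) (x : ℝ) :
    x * laguerre n x = n * laguerre (n - 1) x + (2 * n + 1) * laguerre n x
      + (n + 1) * laguerre (n + 1) x := by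
  cases n with
  | zero => simp [laguerre_one]
  | succ n =>
    rw [laguerre_eq_sum (n := n + 1) (N := n + 2) (by omega), Finset.mul_sum]
    -- The first expansion also hit the middle term on the right; it is folded back and expanded
    -- over the longer range shared by the three terms.
    rw [← laguerre_eq_sum (n := n + 1) (N := n + 2) (by omega),
      laguerre_eq_sum (n := n + 1) (N := n + 3) (by omega),
      laguerre_eq_sum (n := n + 1 - 1) (N := n + 3) (by omega),
      laguerre_eq_sum (n := n + 1 + 1) (N := n + 3) (by omega),
      Finset.mul_sum, Finset.mul_sum, Finset.mul_sum, ← Finset.sum_add_distrib,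
      ← Finset.sum_add_distrib, Finset.sum_range_succ' _ (n + 2)]
    simp only [Nat.add_sub_cancel]
    -- Constant terms alternate between `1` and `-1`, and `(n + 1) - (2n + 3) + (n + 2) = 0`.
    have h0 : ((n + 1 : ℕ) : ℝ) * (laguerreCoeff n 0 * x ^ 0) + (2 * ((n + 1 : ℕ) : ℝ) + 1) *
        (laguerreCoeff (n + 1) 0 * x ^ 0) + (((n + 1 : ℕ) : ℝ) + 1) *
        (laguerreCoeff (n + 1 + 1) 0 * x ^ 0) = 0 := by
      simp [laguerreCoeff, pow_add]
      ring
    rw [h0, add_zero]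
    refine Finset.sum_congr rfl fun k _ => ?_
    rw [← laguerreCoeff_succ]
    push_cast
    ring

theorem memLp_pow_expMeasure (n : ℕ) : MemLp (fun x : ℝ => x ^ n) 2 expMeasure := by
  obtain ⟨C, -, h⟩ := abs_pow_mul_exp_le (a := 1 / 4) (by norm_num) n
  refine ((memLp_exp_abs_expMeasure (t := 1 / 4) (by norm_num)).const_mul C).mono'
    (by fun_prop) (ae_of_all _ fun x => ?_)
  rw [norm_pow]
  exact h x

theorem memLp_pow_mul_laguerre (m n : ℕ) :
    MemLp (fun x : ℝ => x ^ m * laguerre n x) 2 expMeasure := by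
  simp only [laguerre, Finset.mul_sum]
  refine memLp_finsetSum _ fun k _ => ?_
  convert (memLp_pow_expMeasure (m + k)).const_mul (laguerreCoeff n k) using 2 with x
  ring

theorem memLp_laguerre (n : ℕ) : MemLp (laguerre n) 2 expMeasure := by
  simpa using memLp_pow_mul_laguerre 0 n

/-- The moment `k!` cancels the denominator of the `k`-th coefficient, leaving `(-1)ⁿ (1 - 1)ⁿ`. -/
theorem integral_laguerre (n : ℕ) :
    ∫ x, laguerre n x ∂expMeasure = if 0 = n then 1 else 0 := by
  simp only [laguerre]
  rw [integral_finsetSum]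
  · simp only [integral_const_mul, integral_pow_expMeasure, laguerreCoeff]
    have h := add_pow (-1 : ℝ) 1 n
    rw [neg_add_cancel] at h
    have h2 : ∀ k ∈ Finset.range (n + 1), (-1 : ℝ) ^ (n + k) * (n.choose k : ℝ) / (k.factorial : ℝ)
        * (k.factorial : ℝ) = (-1) ^ n * ((-1) ^ k * 1 ^ (n - k) * (n.choose k : ℝ)) := by
      intro k _
      have hf : ((k.factorial : ℕ) : ℝ) ≠ 0 := by positivity
      rw [div_mul_cancel₀ _ hf, pow_add]
      simp [mul_assoc]
    rw [Finset.sum_congr rfl h2, ← Finset.mul_sum, ← h]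
    rcases n with _ | n <;> simp
  · intro k _
    exact ((memLp_pow_expMeasure k).integrable (by norm_num)).const_mul _

theorem integral_add_smul_three {F : Type*} [NormedAddCommGroup F] [NormedSpace ℝ F]
    {ρ : Measure ℝ} {f g h : ℝ → F} (hf : Integrable f ρ) (hg : Integrable g ρ)
    (hh : Integrable h ρ) (a b c : ℝ) :
    ∫ x, a • f x + b • g x + c • h x ∂ρ =
      a • ∫ x, f x ∂ρ + b • ∫ x, g x ∂ρ + c • ∫ x, h x ∂ρ := by
  have h1 : Integrable (fun x => a • f x + b • g x) ρ := (hf.smul a).add (hg.smul b)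
  have h2 : Integrable (fun x => c • h x) ρ := hh.smul c
  have h3 : Integrable (fun x => a • f x) ρ := hf.smul a
  have h4 : Integrable (fun x => b • g x) ρ := hg.smul b
  rw [integral_add h1 h2, integral_add h3 h4]
  simp only [integral_smul]

/-- Applying the recurrence to either factor of `∫ x pₘ pₙ` expresses row `m + 1` of the Gram matrix
through rows `m` and `m - 1`; row `0` is `integral_laguerre`. -/
theorem integral_laguerre_mul_laguerre (m n : ℕ) :
    ∫ x, laguerre m x * laguerre n x ∂expMeasure = if m = n then 1 else 0 := by
  have hi : ∀ m n, Integrable (fun x => laguerre m x * laguerre n x) expMeasure := fun m n =>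
    (memLp_laguerre m).integrable_mul (memLp_laguerre n)
  have hrec : ∀ m n : ℕ, ∫ x, (x * laguerre m x) * laguerre n x ∂expMeasure =
      m * ∫ x, laguerre (m - 1) x * laguerre n x ∂expMeasure
      + (2 * m + 1) * ∫ x, laguerre m x * laguerre n x ∂expMeasure
      + (m + 1) * ∫ x, laguerre (m + 1) x * laguerre n x ∂expMeasure := by
    intro m n
    have e : ∀ x, (x * laguerre m x) * laguerre n x =
        (m : ℝ) • (laguerre (m - 1) x * laguerre n x)
        + (2 * m + 1 : ℝ) • (laguerre m x * laguerre n x)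
        + (m + 1 : ℝ) • (laguerre (m + 1) x * laguerre n x) := by
      intro x
      rw [laguerre_recurrence]
      simp only [smul_eq_mul]
      ring
    simp only [e]
    rw [integral_add_smul_three (hi _ _) (hi _ _) (hi _ _)]
    simp only [smul_eq_mul]
  induction m using Nat.strong_induction_on generalizing n with
  | _ m ih =>
    cases m with
    | zero => simpa using integral_laguerre n
    | succ m =>
      have h1 := hrec m n
      have h2 := hrec n m
      have h3 : ∫ x, (x * laguerre m x) * laguerre n x ∂expMeasure =
          ∫ x, (x * laguerre n x) * laguerre m x ∂expMeasure := by
        congr 1; funext x; ring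
      have hc : ∀ k l, ∫ x, laguerre k x * laguerre l x ∂expMeasure =
          ∫ x, laguerre l x * laguerre k x ∂expMeasure := fun k l => by simp only [mul_comm]
      -- Symmetry puts the index `m` first, where the induction hypothesis applies.
      rw [hc (n - 1) m, hc n m, hc (n + 1) m] at h2
      rw [← h3, h1] at h2
      simp only [ih m (by omega), ih (m - 1) (by omega)] at h2
      have hm : ((m : ℝ) + 1) ≠ 0 := by positivity
      refine mul_left_cancel₀ hm ?_
      rw [eq_sub_of_add_eq' h2]
      have e1 : (n : ℝ) * (if m = n - 1 then 1 else 0) = if m + 1 = n then (m : ℝ) + 1 else 0 := by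
        rcases n with _ | n
        · simp
        · by_cases h : m = n <;> simp [h]
      have e2 : (m : ℝ) * (if m - 1 = n then 1 else 0) = if m = n + 1 then (n : ℝ) + 1 else 0 := by
        rcases m with _ | m
        · simp
        · by_cases h : m = n <;> simp [h]
      have e3 : (2 * (n : ℝ) + 1) * (if m = n then 1 else 0) =
          (2 * (m : ℝ) + 1) * (if m = n then 1 else 0) := by
        by_cases h : m = n <;> simp [h]
      rw [e1, e2, e3]
      simp only [mul_ite, mul_one, mul_zero]
      ring

theorem integrable_pow_mul_laguerre_mul {F : Type*} [NormedAddCommGroup F] [NormedSpace ℝ F]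
    {ρ : Measure ℝ} {g : ℝ → F} {a : ℝ} (ha : 0 < a) (hm : AEStronglyMeasurable g ρ)
    (hg : Integrable (fun x => Real.exp (a * |x|) • g x) ρ) (m n : ℕ) :
    Integrable (fun x => (x ^ m * laguerre n x) • g x) ρ := by
  simp only [laguerre, Finset.mul_sum, Finset.sum_smul]
  refine integrable_finsetSum _ fun k _ => ?_
  refine ((integrable_pow_mul ha hm hg (m + k)).smul (laguerreCoeff n k)).congr
    (ae_of_all _ fun x => ?_)
  simp only [Pi.smul_apply, smul_smul]
  ring_nf

/-- A density with exponential decay that is orthogonal to all Laguerre polynomials is zero. -/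
theorem ae_eq_zero_of_integral_laguerre {ρ : Measure ℝ} {g : ℝ → ℂ} {a : ℝ} (ha : 0 < a)
    (hm : AEStronglyMeasurable g ρ)
    (hg : Integrable (fun x => Real.exp (a * |x|) • g x) ρ)
    (h : ∀ n : ℕ, ∫ x, laguerre n x • g x ∂ρ = 0) : g =ᵐ[ρ] 0 := by
  have hi := integrable_pow_mul_laguerre_mul ha hm hg
  -- Each use of the recurrence trades a power of `x` for neighbouring polynomials, so all `x ^ m *
  -- laguerre n x` are annihilated; `n = 0` gives the plain moments.
  have key : ∀ m n : ℕ, ∫ x, (x ^ m * laguerre n x) • g x ∂ρ = 0 := by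
    intro m
    induction m with
    | zero => simpa using h
    | succ m ih =>
      intro n
      have e : ∀ x, (x ^ (m + 1) * laguerre n x) • g x =
          (n : ℝ) • ((x ^ m * laguerre (n - 1) x) • g x)
          + (2 * n + 1 : ℝ) • ((x ^ m * laguerre n x) • g x)
          + (n + 1 : ℝ) • ((x ^ m * laguerre (n + 1) x) • g x) := by
        intro x
        simp only [smul_smul, ← add_smul]
        rw [pow_succ, mul_assoc, laguerre_recurrence]
        ring_nf
      simp only [e]
      rw [integral_add_smul_three (hi _ _) (hi _ _) (hi _ _)]
      simp only [ih, smul_zero, add_zero]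
  exact ae_eq_zero_of_moments ha hm hg fun n => by simpa using key n 0

/-- By Cauchy–Schwarz, since the exponential is itself square integrable for `t < 1 / 2`. This makes
the moment criterion available for all of `L²(ρ)`. -/
theorem integrable_exp_abs_smul_of_memLp {f : ℝ → ℂ} (hf : MemLp f 2 expMeasure) {t : ℝ}
    (ht : t < 1 / 2) : Integrable (fun x => Real.exp (t * |x|) • f x) expMeasure :=
  hf.smul (memLp_exp_abs_expMeasure ht) |>.integrable le_rfl

/-- The product `x f` need not lie in `L²`, but the moment criterion still applies to it: of the
exponent `1 / 4` available for `f`, half absorbs the factor `|x|`. -/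
theorem integrable_exp_abs_smul_mul_of_memLp {f : ℝ → ℂ} (hf : MemLp f 2 expMeasure) :
    Integrable (fun x : ℝ => Real.exp (1 / 8 * |x|) • ((x : ℂ) * f x)) expMeasure := by
  obtain ⟨C, hC, h⟩ := abs_pow_mul_exp_le (a := 1 / 8) (by norm_num) 1
  refine ((integrable_exp_abs_smul_of_memLp hf (t := 1 / 4) (by norm_num)).norm.const_mul C).mono'
    ?_ (ae_of_all _ fun x => ?_)
  · have := hf.1
    fun_prop
  · rw [norm_smul, norm_smul, norm_mul, Real.norm_eq_abs, Real.norm_eq_abs, Real.abs_exp,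
      Real.abs_exp, Complex.norm_real, Real.norm_eq_abs,
      show (1 / 4 : ℝ) * |x| = 1 / 8 * |x| + 1 / 8 * |x| by ring, Real.exp_add]
    have h1 := h x
    rw [pow_one] at h1
    calc Real.exp (1 / 8 * |x|) * (|x| * ‖f x‖)
        ≤ Real.exp (1 / 8 * |x|) * ((C * Real.exp (1 / 8 * |x|)) * ‖f x‖) := by gcongr
      _ = _ := by ring

/-! ### The Laguerre transform and its intertwining property -/

theorem memLp_ofReal_laguerre (n : ℕ) :
    MemLp (fun x : ℝ => (laguerre n x : ℂ)) 2 expMeasure :=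
  (memLp_laguerre n).ofReal

/-- The sign-normalized Laguerre polynomials as elements of the weighted `L²` space. -/
def laguerreLp (n : ℕ) : Lp ℂ 2 expMeasure := (memLp_ofReal_laguerre n).toLp _

theorem coeFn_laguerreLp (n : ℕ) :
    laguerreLp n =ᵐ[expMeasure] fun x : ℝ => (laguerre n x : ℂ) :=
  MemLp.coeFn_toLp _

theorem inner_laguerreLp (n : ℕ) (f : Lp ℂ 2 expMeasure) :
    inner ℂ (laguerreLp n) f = ∫ x, laguerre n x • f x ∂expMeasure := by
  rw [L2.inner_def]
  refine integral_congr_ae ?_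
  filter_upwards [coeFn_laguerreLp n] with x hx
  rw [hx]
  simp [mul_comm]

theorem orthonormal_laguerreLp : Orthonormal ℂ laguerreLp := by
  rw [orthonormal_iff_ite]
  intro m n
  rw [inner_laguerreLp]
  have h : ∫ x, laguerre m x • laguerreLp n x ∂expMeasure =
      ∫ x, ((laguerre m x * laguerre n x : ℝ) : ℂ) ∂expMeasure := by
    refine integral_congr_ae ?_
    filter_upwards [coeFn_laguerreLp n] with x hx
    rw [hx]
    simp
  rw [h, integral_complex_ofReal, integral_laguerre_mul_laguerre]
  split_ifs <;> simp

theorem span_laguerreLp_orthogonal : (Submodule.span ℂ (Set.range laguerreLp))ᗮ = ⊥ := by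
  rw [Submodule.eq_bot_iff]
  intro f hf
  rw [Submodule.mem_orthogonal] at hf
  refine Lp.ext ((ae_eq_zero_of_integral_laguerre (a := 1 / 4) (by norm_num)
    (Lp.aestronglyMeasurable f)
    (integrable_exp_abs_smul_of_memLp (Lp.memLp f) (by norm_num)) fun n => ?_).trans
    (Lp.coeFn_zero _ _ _).symm)
  rw [← inner_laguerreLp]
  exact hf _ (Submodule.subset_span ⟨n, rfl⟩)

/-- The orthonormal basis of Laguerre polynomials. -/
def laguerreBasis : HilbertBasis ℕ ℂ (Lp ℂ 2 expMeasure) :=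
  HilbertBasis.mkOfOrthogonalEqBot orthonormal_laguerreLp span_laguerreLp_orthogonal

/-- The unitary map sending the unit vectors to the Laguerre polynomials. -/
def laguerreTransform : ℓ2 ≃ₗᵢ[ℂ] Lp ℂ 2 expMeasure := laguerreBasis.repr.symm

theorem laguerreTransform_symm_apply (f : Lp ℂ 2 expMeasure) (n : ℕ) :
    (laguerreTransform.symm f : ℓ2) n = ∫ x, laguerre n x • f x ∂expMeasure := by
  rw [← inner_laguerreLp]
  change laguerreBasis.repr f n = _
  rw [HilbertBasis.repr_apply_apply, laguerreBasis, HilbertBasis.coe_mkOfOrthogonalEqBot]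

theorem apply_eq_integral_laguerre (u : ℓ2) (n : ℕ) :
    u n = ∫ x, laguerre n x • laguerreTransform u x ∂expMeasure := by
  rw [← laguerreTransform_symm_apply, LinearIsometryEquiv.symm_apply_apply]

theorem laguerreTransform_single (n : ℕ) :
    laguerreTransform (lp.single 2 n (1 : ℂ)) = laguerreLp n := by
  refine (HilbertBasis.repr_symm_single laguerreBasis n).trans ?_
  rw [laguerreBasis, HilbertBasis.coe_mkOfOrthogonalEqBot]

theorem laguerreTransform_delta0 :
    ∀ᵐ x ∂expMeasure, laguerreTransform delta0 x = 1 := by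
  filter_upwards [coeFn_laguerreLp 0] with x hx
  rw [delta0, laguerreTransform_single, hx]
  simp

/-- The recurrence under the integral sign. Only exponential integrability is required, so no domain
condition enters. -/
theorem tau_integral_laguerre {ρ : Measure ℝ} {g : ℝ → ℂ} {a : ℝ} (ha : 0 < a)
    (hm : AEStronglyMeasurable g ρ)
    (hg : Integrable (fun x => Real.exp (a * |x|) • g x) ρ) (n : ℕ) :
    tau (fun n => ∫ x, laguerre n x • g x ∂ρ) n = ∫ x, laguerre n x • ((x : ℂ) * g x) ∂ρ := by
  have hi : ∀ n, Integrable (fun x => laguerre n x • g x) ρ := fun n => by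
    simpa using integrable_pow_mul_laguerre_mul ha hm hg 0 n
  have e : ∀ n (x : ℝ), laguerre n x • ((x : ℂ) * g x) =
      (n : ℝ) • (laguerre (n - 1) x • g x) + (2 * n + 1 : ℝ) • (laguerre n x • g x)
        + (n + 1 : ℝ) • (laguerre (n + 1) x • g x) := by
    intro n x
    rw [← Complex.real_smul, smul_smul, mul_comm, laguerre_recurrence]
    simp only [smul_smul, ← add_smul]
  simp only [e]
  rw [integral_add_smul_three (hi _) (hi _) (hi _)]
  cases n <;> simp [tau]

/-- The Laguerre transform carries `τ` to multiplication by the independent variable. -/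
theorem tau_apply_eq_integral (u : ℓ2) (n : ℕ) :
    tau u n = ∫ x, laguerre n x • ((x : ℂ) * laguerreTransform u x) ∂expMeasure := by
  rw [← tau_integral_laguerre (a := 1 / 4) (by norm_num) (Lp.aestronglyMeasurable _)
    (integrable_exp_abs_smul_of_memLp (Lp.memLp _) (by norm_num))]
  simp only [← apply_eq_integral_laguerre]

/-- Square integrability of `x · Uu` is a consequence here, so injectivity on `L²` cannot be
invoked. Instead the difference of the two sides has exponential decay and vanishing Laguerre
coefficients. -/
theorem laguerreTransform_ae_eq_of_tau_eq {u v : ℓ2} (h : tau u = v) :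
    laguerreTransform v =ᵐ[expMeasure] fun x : ℝ => (x : ℂ) * laguerreTransform u x := by
  have hu := integrable_exp_abs_smul_mul_of_memLp (Lp.memLp (laguerreTransform u))
  have hv := integrable_exp_abs_smul_of_memLp (Lp.memLp (laguerreTransform v)) (t := 1 / 8)
    (by norm_num)
  have hum : AEStronglyMeasurable (fun x : ℝ => (x : ℂ) * laguerreTransform u x) expMeasure := by
    have := Lp.aestronglyMeasurable (laguerreTransform u)
    fun_prop
  have hvm := Lp.aestronglyMeasurable (laguerreTransform v)
  have key := ae_eq_zero_of_integral_laguerre (ρ := expMeasure) (a := 1 / 8)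
    (g := fun x => laguerreTransform v x - (x : ℂ) * laguerreTransform u x) (by norm_num)
    (hvm.sub hum) ((hv.sub hu).congr
      (ae_of_all _ fun x => by simp only [Pi.sub_apply, smul_sub])) fun n => by
      have hiu := integrable_pow_mul_laguerre_mul (by norm_num) hum hu 0 n
      have hiv := integrable_pow_mul_laguerre_mul (by norm_num) hvm hv 0 n
      simp only [pow_zero, one_mul] at hiu hiv
      simp only [smul_sub]
      rw [integral_sub hiv hiu, ← tau_apply_eq_integral, ← apply_eq_integral_laguerre, h, sub_self]
  filter_upwards [key] with x hx
  exact sub_eq_zero.1 hx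

theorem tau_eq_laguerreTransform_symm {u : ℓ2}
    (h : MemLp (fun x : ℝ => (x : ℂ) * laguerreTransform u x) 2 expMeasure) :
    tau u = laguerreTransform.symm (h.toLp _) := by
  funext n
  rw [laguerreTransform_symm_apply, tau_apply_eq_integral]
  refine integral_congr_ae ?_
  filter_upwards [h.coeFn_toLp] with x hx
  rw [hx]

theorem mem_domain_H0_iff (u : ℓ2) :
    u ∈ H0.domain ↔ MemLp (fun x : ℝ => (x : ℂ) * laguerreTransform u x) 2 expMeasure := by
  refine ⟨fun hu => ?_, fun h => ?_⟩
  · exact (Lp.memLp _).ae_eq (laguerreTransform_ae_eq_of_tau_eq (v := H0 ⟨u, hu⟩) rfl)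
  · change Memℓp (tau u) 2
    rw [tau_eq_laguerreTransform_symm h]
    exact lp.memℓp _

theorem laguerreTransform_H0 (u : H0.domain) :
    laguerreTransform (H0 u) =ᵐ[expMeasure] fun x : ℝ => (x : ℂ) * laguerreTransform (u : ℓ2) x :=
  laguerreTransform_ae_eq_of_tau_eq (v := H0 u) rfl

theorem isSpectralTransform_laguerreTransform :
    IsSpectralTransform H0 delta0 expMeasure laguerreTransform :=
  ⟨laguerreTransform_delta0, mem_domain_H0_iff, laguerreTransform_H0⟩

/-! ### Bounded multiplication operators on `L²` -/

section Multiplication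

variable {ρ : Measure ℝ}

theorem memLp_mul_of_bound {φ : ℝ → ℂ} {C : ℝ} (hφ : AEStronglyMeasurable φ ρ)
    (hC : ∀ᵐ x ∂ρ, ‖φ x‖ ≤ C) (f : Lp ℂ 2 ρ) : MemLp (fun x => φ x * f x) 2 ρ := by
  refine (Lp.memLp f).of_le_mul (c := C) (hφ.mul (Lp.aestronglyMeasurable f)) ?_
  filter_upwards [hC] with x hx
  rw [norm_mul]
  gcongr

/-- Multiplication by an essentially bounded function in `L²`. -/
def mulCLM (φ : ℝ → ℂ) {C : ℝ} (hφ : AEStronglyMeasurable φ ρ) (hC : ∀ᵐ x ∂ρ, ‖φ x‖ ≤ C) :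
    Lp ℂ 2 ρ →L[ℂ] Lp ℂ 2 ρ :=
  LinearMap.mkContinuous
    { toFun := fun f => (memLp_mul_of_bound hφ hC f).toLp _
      map_add' := fun f g => by
        refine Lp.ext ?_
        filter_upwards [(memLp_mul_of_bound hφ hC (f + g)).coeFn_toLp,
          (memLp_mul_of_bound hφ hC f).coeFn_toLp, (memLp_mul_of_bound hφ hC g).coeFn_toLp,
          Lp.coeFn_add f g, Lp.coeFn_add ((memLp_mul_of_bound hφ hC f).toLp _)
            ((memLp_mul_of_bound hφ hC g).toLp _)] with x h1 h2 h3 h4 h5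
        simp only [h1, h2, h3, h4, h5, Pi.add_apply, mul_add]
      map_smul' := fun c f => by
        refine Lp.ext ?_
        filter_upwards [(memLp_mul_of_bound hφ hC (c • f)).coeFn_toLp,
          (memLp_mul_of_bound hφ hC f).coeFn_toLp, Lp.coeFn_smul c f,
          Lp.coeFn_smul c ((memLp_mul_of_bound hφ hC f).toLp _)] with x h1 h2 h3 h4
        simp only [h1, h2, h3, h4, Pi.smul_apply, smul_eq_mul, RingHom.id_apply]
        ring }
    C fun f => by
      refine Lp.norm_le_mul_norm_of_ae_le_mul ?_
      filter_upwards [(memLp_mul_of_bound hφ hC f).coeFn_toLp, hC] with x h1 h2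
      simp only [LinearMap.coe_mk, AddHom.coe_mk, h1, norm_mul]
      gcongr

theorem coeFn_mulCLM {φ : ℝ → ℂ} {C : ℝ} (hφ : AEStronglyMeasurable φ ρ)
    (hC : ∀ᵐ x ∂ρ, ‖φ x‖ ≤ C) (f : Lp ℂ 2 ρ) :
    mulCLM φ hφ hC f =ᵐ[ρ] fun x => φ x * f x :=
  (memLp_mul_of_bound hφ hC f).coeFn_toLp

/-- Restriction to a measurable set in `L²`. -/
def restrictCLM (ρ : Measure ℝ) {B : Set ℝ} (hB : MeasurableSet B) : Lp ℂ 2 ρ →L[ℂ] Lp ℂ 2 ρ :=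
  mulCLM (C := 1) (B.indicator fun _ => (1 : ℂ))
    (aestronglyMeasurable_const.indicator hB)
    (ae_of_all _ fun x => by by_cases h : x ∈ B <;> simp [h])

theorem coeFn_restrictCLM {B : Set ℝ} (hB : MeasurableSet B) (f : Lp ℂ 2 ρ) :
    restrictCLM ρ hB f =ᵐ[ρ] B.indicator f := by
  filter_upwards [coeFn_mulCLM (C := 1) (φ := B.indicator fun _ => (1 : ℂ))
    (aestronglyMeasurable_const.indicator hB)
    (ae_of_all ρ fun x => by by_cases h : x ∈ B <;> simp [h]) f] with x hx
  rw [restrictCLM, hx]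
  by_cases h : x ∈ B <;> simp [h]

theorem inner_restrictCLM {B : Set ℝ} (hB : MeasurableSet B) (f : Lp ℂ 2 ρ) :
    inner ℂ f (restrictCLM ρ hB f) = ((∫ x in B, ‖f x‖ ^ 2 ∂ρ : ℝ) : ℂ) := by
  rw [L2.inner_def, ← integral_complex_ofReal, ← integral_indicator hB]
  refine integral_congr_ae ?_
  filter_upwards [coeFn_restrictCLM hB f] with x hx
  rw [hx]
  by_cases h : x ∈ B
  · simp [h]
  · simp [h]

theorem restrictCLM_comp {B C : Set ℝ} (hB : MeasurableSet B) (hC : MeasurableSet C)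
    (f : Lp ℂ 2 ρ) :
    restrictCLM ρ hB (restrictCLM ρ hC f) = restrictCLM ρ (hB.inter hC) f := by
  refine Lp.ext ?_
  filter_upwards [coeFn_restrictCLM hB (restrictCLM ρ hC f), coeFn_restrictCLM hC f,
    coeFn_restrictCLM (hB.inter hC) f] with x h1 h2 h3
  rw [h1, h3]
  by_cases hb : x ∈ B <;> by_cases hc : x ∈ C <;> simp [hb, hc, h2]

theorem inner_restrictCLM_comm {B : Set ℝ} (hB : MeasurableSet B) (f g : Lp ℂ 2 ρ) :
    inner ℂ (restrictCLM ρ hB f) g = inner ℂ f (restrictCLM ρ hB g) := by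
  rw [L2.inner_def, L2.inner_def]
  refine integral_congr_ae ?_
  filter_upwards [coeFn_restrictCLM hB f, coeFn_restrictCLM hB g] with x h1 h2
  rw [h1, h2]
  by_cases h : x ∈ B <;> simp [h]

theorem isStarProjection_restrictCLM {B : Set ℝ} (hB : MeasurableSet B) :
    IsStarProjection (restrictCLM ρ hB) := by
  refine ⟨?_, ?_⟩
  · ext1 f
    rw [mul_apply_eq_comp, restrictCLM_comp]
    congr 2
    exact Set.inter_self B
  · rw [ContinuousLinearMap.isSelfAdjoint_iff_isSymmetric]
    exact inner_restrictCLM_comm hB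

theorem restrictCLM_univ : restrictCLM ρ MeasurableSet.univ = 1 := by
  ext1 f
  refine Lp.ext ?_
  filter_upwards [coeFn_restrictCLM MeasurableSet.univ f] with x hx
  simp [hx]

theorem inner_self_eq_ofReal_norm_sq {H : Type*} [NormedAddCommGroup H] [InnerProductSpace ℂ H]
    (v : H) : inner ℂ v v = ((‖v‖ ^ 2 : ℝ) : ℂ) := by
  rw [inner_self_eq_norm_sq_to_K]
  simp

/-- Parseval's criterion for the convergence of an orthogonal series. -/
theorem hasSum_of_hasSum_norm_sq {H : Type*} [NormedAddCommGroup H] [InnerProductSpace ℂ H]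
    {v : ℕ → H} {w : H} (hv : Pairwise fun m n => inner ℂ (v m) (v n) = 0)
    (hw : ∀ n, inner ℂ w (v n) = ((‖v n‖ ^ 2 : ℝ) : ℂ))
    (h : HasSum (fun n => ‖v n‖ ^ 2) (‖w‖ ^ 2)) : HasSum v w := by
  have hs : ∀ s : Finset ℕ, ‖w - ∑ n ∈ s, v n‖ ^ 2 = ‖w‖ ^ 2 - ∑ n ∈ s, ‖v n‖ ^ 2 := by
    intro s
    have h1 : inner ℂ w (∑ n ∈ s, v n) = ((∑ n ∈ s, ‖v n‖ ^ 2 : ℝ) : ℂ) := by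
      rw [inner_sum, Complex.ofReal_sum]
      exact Finset.sum_congr rfl fun n _ => hw n
    have h2 : ‖∑ n ∈ s, v n‖ ^ 2 = ∑ n ∈ s, ‖v n‖ ^ 2 := by
      have h3 : inner ℂ (∑ n ∈ s, v n) (∑ n ∈ s, v n) = ((∑ n ∈ s, ‖v n‖ ^ 2 : ℝ) : ℂ) := by
        rw [sum_inner, Complex.ofReal_sum]
        refine Finset.sum_congr rfl fun n hn => ?_
        rw [inner_sum, Finset.sum_eq_single_of_mem n hn fun m _ hm => hv hm.symm]
        exact inner_self_eq_ofReal_norm_sq _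
      rw [inner_self_eq_ofReal_norm_sq] at h3
      exact_mod_cast h3
    rw [norm_sub_sq (𝕜 := ℂ), h1, h2, RCLike.re_eq_complex_re, Complex.ofReal_re]
    ring
  rw [HasSum, tendsto_iff_norm_sub_tendsto_zero]
  have ht : Filter.Tendsto (fun s : Finset ℕ => ‖w‖ ^ 2 - ∑ n ∈ s, ‖v n‖ ^ 2)
      Filter.atTop (nhds 0) := by
    rw [← sub_self (‖w‖ ^ 2)]
    exact tendsto_const_nhds.sub h
  have ht2 := (Real.continuous_sqrt.tendsto 0).comp ht
  simp only [Real.sqrt_zero] at ht2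
  refine ht2.congr fun s => ?_
  rw [Function.comp_apply, ← hs, Real.sqrt_sq (norm_nonneg _), norm_sub_rev]

theorem norm_restrictCLM_sq {B : Set ℝ} (hB : MeasurableSet B) (f : Lp ℂ 2 ρ) :
    ‖restrictCLM ρ hB f‖ ^ 2 = ∫ x in B, ‖f x‖ ^ 2 ∂ρ := by
  have h := inner_restrictCLM_comm hB f (restrictCLM ρ hB f)
  rw [restrictCLM_comp, inner_self_eq_ofReal_norm_sq, inner_restrictCLM, Set.inter_self] at h
  exact_mod_cast h

theorem integrable_norm_sq (f : Lp ℂ 2 ρ) : Integrable (fun x => ‖f x‖ ^ 2) ρ :=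
  (memLp_two_iff_integrable_sq_norm (Lp.aestronglyMeasurable f)).1 (Lp.memLp f)

/-- Restrictions to disjoint sets are orthogonal and their squared norms are set integrals, which
are countably additive; Parseval's criterion then gives strong convergence. -/
theorem hasSum_restrictCLM {B : ℕ → Set ℝ} (hB : ∀ n, MeasurableSet (B n))
    (hd : Pairwise (Function.onFun Disjoint B)) (f : Lp ℂ 2 ρ) :
    HasSum (fun n => restrictCLM ρ (hB n) f) (restrictCLM ρ (MeasurableSet.iUnion hB) f) := by
  refine hasSum_of_hasSum_norm_sq (fun m n hmn => ?_) (fun n => ?_) ?_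
  · beta_reduce
    rw [inner_restrictCLM_comm, restrictCLM_comp, inner_restrictCLM, (hd hmn).inter_eq]
    simp
  · rw [inner_restrictCLM_comm, restrictCLM_comp, inner_restrictCLM, norm_restrictCLM_sq,
      Set.inter_eq_self_of_subset_right (Set.subset_iUnion B n)]
  · simp only [norm_restrictCLM_sq]
    exact hasSum_integral_iUnion hB hd (integrable_norm_sq f).integrableOn

end Multiplication

/-! ### Spectral resolution, resolvent and spectrum through a unitary map -/

section Transport

variable {H : Type*} [NormedAddCommGroup H] [InnerProductSpace ℂ H]
  {ρ : Measure ℝ}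

/-- The conjugation of a bounded operator by a unitary map. -/
def conjCLM {K : Type*} [NormedAddCommGroup K] [InnerProductSpace ℂ K] (U : H ≃ₗᵢ[ℂ] K)
    (T : K →L[ℂ] K) : H →L[ℂ] H :=
  (U.symm.toContinuousLinearEquiv : K →L[ℂ] H) ∘L T ∘L (U.toContinuousLinearEquiv : H →L[ℂ] K)

theorem conjCLM_apply {K : Type*} [NormedAddCommGroup K] [InnerProductSpace ℂ K] (U : H ≃ₗᵢ[ℂ] K)
    (T : K →L[ℂ] K) (u : H) : conjCLM U T u = U.symm (T (U u)) := rfl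

open Classical in
/-- The projection-valued measure of multiplication by the independent variable, pulled back along
a unitary map. -/
def spectralResolution [CompleteSpace H] (U : H ≃ₗᵢ[ℂ] Lp ℂ 2 ρ) : ProjectionValuedMeasure H where
  proj B := if hB : MeasurableSet B then conjCLM U (restrictCLM ρ hB) else 0
  isStarProjection B hB := by
    simp only [hB, dif_pos]
    have h := isStarProjection_restrictCLM (ρ := ρ) hB
    refine ⟨?_, ?_⟩
    · ext1 u
      rw [mul_apply_eq_comp]
      simp only [conjCLM_apply, LinearIsometryEquiv.apply_symm_apply, restrictCLM_comp]
      simp only [Set.inter_self]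
    · rw [ContinuousLinearMap.isSelfAdjoint_iff_isSymmetric]
      intro u v
      simp only [ContinuousLinearMap.coe_coe, conjCLM_apply]
      rw [← U.inner_map_map, ← U.inner_map_map u]
      simp only [LinearIsometryEquiv.apply_symm_apply]
      exact inner_restrictCLM_comm hB _ _
  proj_univ := by
    simp only [MeasurableSet.univ, dif_pos, restrictCLM_univ]
    ext1 u
    simp [conjCLM_apply]
  hasSum_proj B hB hd u := by
    simp only [hB, MeasurableSet.iUnion hB, dif_pos, conjCLM_apply]
    exact (U.symm.toContinuousLinearEquiv : Lp ℂ 2 ρ →L[ℂ] H).hasSum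
      (hasSum_restrictCLM hB hd (U u))
  proj_of_not_measurable B hB := by simp [hB]

/-- Every spectral measure thus has a density against `ρ`, which is the source of pure absolute
continuity. -/
theorem scalarMeasure_spectralResolution [CompleteSpace H] (U : H ≃ₗᵢ[ℂ] Lp ℂ 2 ρ) (u : H) :
    (spectralResolution U).scalarMeasure u =
      ρ.withDensity fun x => ENNReal.ofReal (‖U u x‖ ^ 2) := by
  ext B hB
  rw [ProjectionValuedMeasure.scalarMeasure, Measure.ofMeasurable_apply _ hB,
    withDensity_apply _ hB]
  have h : inner ℂ u ((spectralResolution U).proj B u) =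
      ((∫ x in B, ‖U u x‖ ^ 2 ∂ρ : ℝ) : ℂ) := by
    simp only [spectralResolution, hB, dif_pos, conjCLM_apply]
    rw [← U.inner_map_map, LinearIsometryEquiv.apply_symm_apply, inner_restrictCLM]
  rw [h, Complex.ofReal_re, ofReal_integral_eq_lintegral_ofReal
    (integrable_norm_sq (U u)).integrableOn (ae_of_all _ fun x => by positivity)]

theorem inner_eq_integral_of_isSpectralTransform {A : H →ₗ.[ℂ] H} {φ : H}
    {U : H ≃ₗᵢ[ℂ] Lp ℂ 2 ρ} (hU : IsSpectralTransform A φ ρ U) (u : A.domain) :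
    inner ℂ (u : H) (A u) = ((∫ x, x * ‖U (u : H) x‖ ^ 2 ∂ρ : ℝ) : ℂ) := by
  rw [← U.inner_map_map, L2.inner_def, ← integral_complex_ofReal]
  refine integral_congr_ae ?_
  filter_upwards [hU.2.2 u] with x hx
  rw [hx]
  push_cast
  rw [RCLike.inner_apply, mul_assoc, Complex.mul_conj, Complex.normSq_eq_norm_sq]
  push_cast
  rfl

theorem isResolutionOf_spectralResolution [CompleteSpace H] {A : H →ₗ.[ℂ] H} {φ : H}
    {U : H ≃ₗᵢ[ℂ] Lp ℂ 2 ρ} (hU : IsSpectralTransform A φ ρ U) :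
    (spectralResolution U).IsResolutionOf A := by
  have hm : ∀ u, AEMeasurable (fun x => ENNReal.ofReal (‖U u x‖ ^ 2)) ρ := fun u =>
    (integrable_norm_sq (U u)).1.aemeasurable.ennreal_ofReal
  refine ⟨fun u => ?_, fun u => ?_⟩
  · have hmx : AEStronglyMeasurable (fun x : ℝ => (x : ℂ) * U u x) ρ := by
      have := Lp.aestronglyMeasurable (U u)
      fun_prop
    rw [hU.2.1, scalarMeasure_spectralResolution, memLp_two_iff_integrable_sq_norm hmx,
      integrable_withDensity_iff_integrable_smul₀' (hm u) (by simp)]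
    refine integrable_congr (ae_of_all _ fun x => ?_)
    simp only [smul_eq_mul]
    rw [ENNReal.toReal_ofReal (by positivity), norm_mul, mul_pow, Complex.norm_real,
      Real.norm_eq_abs, sq_abs, mul_comm]
  · rw [inner_eq_integral_of_isSpectralTransform hU, scalarMeasure_spectralResolution,
      integral_withDensity_eq_integral_toReal_smul₀ (hm _) (by simp)]
    congr 1
    refine integral_congr_ae (ae_of_all _ fun x => ?_)
    simp only [smul_eq_mul]
    rw [ENNReal.toReal_ofReal (by positivity), mul_comm]

theorem scalarMeasure_cyclic [CompleteSpace H] {A : H →ₗ.[ℂ] H} {φ : H}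
    {U : H ≃ₗᵢ[ℂ] Lp ℂ 2 ρ} (hU : IsSpectralTransform A φ ρ U) :
    (spectralResolution U).scalarMeasure φ = ρ := by
  rw [scalarMeasure_spectralResolution]
  conv_rhs => rw [← withDensity_one (μ := ρ)]
  refine withDensity_congr_ae ?_
  filter_upwards [hU.1] with x hx
  simp [hx]

/-- A left inverse equals a right inverse, so the choice made in `resolvent` is immaterial. -/
theorem IsResolventAt.unique {A : H →ₗ.[ℂ] H} {z : ℂ} {R S : H →L[ℂ] H}
    (hR : IsResolventAt A z R) (hS : IsResolventAt A z S) : R = S := by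
  ext1 v
  obtain ⟨h, hv⟩ := hS.1 v
  have h1 := hR.2 ⟨S v, h⟩
  rwa [hv] at h1

theorem IsResolventAt.resolvent_eq {A : H →ₗ.[ℂ] H} {z : ℂ} {R : H →L[ℂ] H}
    (hR : IsResolventAt A z R) : resolvent A z = R := by
  have h : ∃ R : H →L[ℂ] H, IsResolventAt A z R := ⟨R, hR⟩
  rw [resolvent, dif_pos h]
  exact h.choose_spec.unique hR

/-- Multiplication by `(x - z)⁻¹` is the resolvent of multiplication by `x`. -/
theorem isResolventAt_conjCLM_mulCLM {A : H →ₗ.[ℂ] H} {φ : H} {U : H ≃ₗᵢ[ℂ] Lp ℂ 2 ρ}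
    (hU : IsSpectralTransform A φ ρ U) {z : ℂ} {C : ℝ} (hz : ∀ᵐ x : ℝ ∂ρ, (x : ℂ) ≠ z)
    (hm : AEStronglyMeasurable (fun x : ℝ => ((x : ℂ) - z)⁻¹) ρ)
    (hC : ∀ᵐ x : ℝ ∂ρ, ‖((x : ℂ) - z)⁻¹‖ ≤ C) :
    IsResolventAt A z (conjCLM U (mulCLM _ hm hC)) := by
  refine ⟨fun v => ?_, fun u => ?_⟩
  · have h : conjCLM U (mulCLM _ hm hC) v ∈ A.domain := by
      rw [hU.2.1]
      refine ((Lp.memLp (U v)).add ((Lp.memLp (mulCLM _ hm hC (U v))).const_mul z)).ae_eq ?_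
      filter_upwards [coeFn_mulCLM hm hC (U v), hz] with x h1 h2
      have h3 := sub_ne_zero.2 h2
      simp only [Pi.add_apply, conjCLM_apply, LinearIsometryEquiv.apply_symm_apply, h1]
      field_simp
      ring
    refine ⟨h, U.injective (Lp.ext ?_)⟩
    rw [map_sub, map_smul]
    filter_upwards [hU.2.2 ⟨_, h⟩, coeFn_mulCLM hm hC (U v), hz,
      Lp.coeFn_sub (U (A ⟨_, h⟩)) (z • U (conjCLM U (mulCLM _ hm hC) v)),
      Lp.coeFn_smul z (U (conjCLM U (mulCLM _ hm hC) v))] with x h1 h2 h3 h4 h5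
    have h6 := sub_ne_zero.2 h3
    rw [h4, Pi.sub_apply, h1, h5, Pi.smul_apply]
    simp only [conjCLM_apply, LinearIsometryEquiv.apply_symm_apply, h2, smul_eq_mul]
    field_simp
  · refine U.injective (Lp.ext ?_)
    rw [conjCLM_apply, LinearIsometryEquiv.apply_symm_apply, map_sub, map_smul]
    filter_upwards [hU.2.2 u, coeFn_mulCLM hm hC (U (A u) - z • U (u : H)), hz,
      Lp.coeFn_sub (U (A u)) (z • U (u : H)), Lp.coeFn_smul z (U (u : H))] with x h1 h2 h3 h4 h5
    have h6 := sub_ne_zero.2 h3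
    rw [h2, h4, Pi.sub_apply, h1, h5, Pi.smul_apply, smul_eq_mul]
    field_simp

/-- Real points of the support of the measure belong to the spectrum of multiplication by `x`. -/
theorem mem_spectrum_of_isSpectralTransform [IsFiniteMeasure ρ] {A : H →ₗ.[ℂ] H} {φ : H}
    {U : H ≃ₗᵢ[ℂ] Lp ℂ 2 ρ} (hU : IsSpectralTransform A φ ρ U) {t : ℝ}
    (ht : ∀ ε > 0, ρ (Set.Ioo t (t + ε)) ≠ 0) : (t : ℂ) ∈ spectrum A := by
  rintro ⟨R, hR⟩
  -- The indicator of an interval of length `ε` at `t` is an approximate eigenvector with error `ε`;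
  -- this length gives `‖R‖ * ε < 1`, contradicting boundedness of the inverse by `‖R‖`.
  set ε : ℝ := (‖R‖ + 1)⁻¹ with hε
  have hε0 : 0 < ε := by positivity
  set f : Lp ℂ 2 ρ := indicatorConstLp 2 measurableSet_Ioo
    (measure_ne_top ρ (Set.Ioo t (t + ε))) (1 : ℂ) with hf
  have hfx : f =ᵐ[ρ] (Set.Ioo t (t + ε)).indicator fun _ => (1 : ℂ) := indicatorConstLp_coeFn
  have hf0 : f ≠ 0 := by
    intro h0
    apply ht ε hε0
    have h1 := hfx.symm.trans ((Lp.ext_iff.1 h0).trans (Lp.coeFn_zero _ _ _))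
    rw [Set.indicator_ae_eq_zero] at h1
    simpa [Function.support_const] using h1
  have hmem : U.symm f ∈ A.domain := by
    rw [hU.2.1, LinearIsometryEquiv.apply_symm_apply]
    refine (Lp.memLp f).of_le_mul (c := |t| + ε) ?_ ?_
    · have := Lp.aestronglyMeasurable f
      fun_prop
    · filter_upwards [hfx] with x hx
      rw [hx]
      by_cases h : x ∈ Set.Ioo t (t + ε)
      · simp only [h, Set.indicator_of_mem, mul_one, Complex.norm_real, norm_one, Real.norm_eq_abs]
        rw [abs_le]
        constructor
        · linarith [neg_abs_le t, h.1]
        · linarith [le_abs_self t, h.2]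
      · simp [h]
  have h1 := hR.2 ⟨U.symm f, hmem⟩
  have h2 : ‖A ⟨U.symm f, hmem⟩ - (t : ℂ) • U.symm f‖ ≤ ε * ‖f‖ := by
    rw [← U.norm_map, map_sub, map_smul, LinearIsometryEquiv.apply_symm_apply]
    refine Lp.norm_le_mul_norm_of_ae_le_mul ?_
    filter_upwards [hU.2.2 ⟨U.symm f, hmem⟩, hfx,
      Lp.coeFn_sub (U (A ⟨U.symm f, hmem⟩)) ((t : ℂ) • f), Lp.coeFn_smul (t : ℂ) f]
      with x h1 h2 h3 h4
    rw [h3, Pi.sub_apply, h1, h4, Pi.smul_apply, LinearIsometryEquiv.apply_symm_apply, smul_eq_mul,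
      ← sub_mul, norm_mul, h2]
    by_cases h : x ∈ Set.Ioo t (t + ε)
    · gcongr
      rw [← Complex.ofReal_sub, Complex.norm_real, Real.norm_eq_abs, abs_le]
      constructor <;> linarith [h.1, h.2]
    · simp [h]
  have h3 : ‖f‖ ≤ ‖R‖ * (ε * ‖f‖) := by
    calc ‖f‖ = ‖U.symm f‖ := (U.symm.norm_map f).symm
      _ = ‖R (A ⟨U.symm f, hmem⟩ - (t : ℂ) • U.symm f)‖ := by rw [h1]
      _ ≤ ‖R‖ * ‖A ⟨U.symm f, hmem⟩ - (t : ℂ) • U.symm f‖ := R.le_opNorm _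
      _ ≤ ‖R‖ * (ε * ‖f‖) := by gcongr
  have h4 : 0 < ‖f‖ := norm_pos_iff.2 hf0
  have h5 : ‖R‖ * ε < 1 := by
    rw [hε, ← div_eq_mul_inv, div_lt_one (by positivity)]
    linarith
  nlinarith

end Transport

/-! ### Self-adjointness and positivity -/

theorem memLp_mul_laguerreLp (n : ℕ) :
    MemLp (fun x : ℝ => (x : ℂ) * laguerreLp n x) 2 expMeasure := by
  refine (memLp_pow_mul_laguerre 1 n).ofReal.ae_eq ?_
  filter_upwards [coeFn_laguerreLp n] with x hx
  rw [hx]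
  simp

theorem single_mem_domain_H0 (n : ℕ) : lp.single 2 n (1 : ℂ) ∈ H0.domain := by
  rw [mem_domain_H0_iff, laguerreTransform_single]
  exact memLp_mul_laguerreLp n

/-- Here `v` is arbitrary in `ℓ²`: testing against unit vectors recovers `τ v` entrywise, which
identifies the action of the adjoint. -/
theorem inner_H0_single (n : ℕ) (v : ℓ2) :
    inner ℂ (H0 ⟨_, single_mem_domain_H0 n⟩) v = tau v n := by
  rw [← laguerreTransform.inner_map_map, L2.inner_def, tau_apply_eq_integral]
  refine integral_congr_ae ?_
  filter_upwards [laguerreTransform_H0 ⟨_, single_mem_domain_H0 n⟩, coeFn_laguerreLp n]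
    with x h1 h2
  rw [h1, laguerreTransform_single, h2]
  simp
  ring

theorem dense_domain_H0 : Dense (H0.domain : Set ℓ2) := by
  rw [Submodule.dense_iff_topologicalClosure_eq_top, Submodule.topologicalClosure_eq_top_iff,
    Submodule.eq_bot_iff]
  intro v hv
  rw [Submodule.mem_orthogonal] at hv
  ext n
  have h := hv _ (single_mem_domain_H0 n)
  rw [lp.inner_single_left] at h
  simpa using h

theorem isFormalAdjoint_H0 : H0.IsFormalAdjoint H0 := by
  intro u v
  rw [← laguerreTransform.inner_map_map, ← laguerreTransform.inner_map_map (u : ℓ2), L2.inner_def,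
    L2.inner_def]
  refine integral_congr_ae ?_
  filter_upwards [laguerreTransform_H0 u, laguerreTransform_H0 v] with x h1 h2
  rw [h1, h2]
  simp
  ring

/-- The adjoint acts as `τ`, so maximality of the domain puts it inside `H0`; symmetry, visible in
`L²(ρ)`, gives the reverse inclusion. -/
theorem isSelfAdjoint_H0 : IsSelfAdjoint H0 := by
  rw [LinearPMap.isSelfAdjoint_def]
  have h : ∀ v : H0.adjoint.domain, tau (v : ℓ2) = (H0.adjoint v : ℓ2) := by
    intro v
    funext n
    have h1 := LinearPMap.adjoint_isFormalAdjoint dense_domain_H0 v ⟨_, single_mem_domain_H0 n⟩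
    rw [← inner_conj_symm (v : ℓ2), inner_H0_single, lp.inner_single_right] at h1
    have h2 := congrArg (starRingEnd ℂ) h1
    simpa using h2.symm
  refine le_antisymm (And.intro (fun v hv => ?_) fun v w hvw => ?_)
    (LinearPMap.IsFormalAdjoint.le_adjoint dense_domain_H0 isFormalAdjoint_H0)
  · change Memℓp (tau v) 2
    rw [h ⟨v, hv⟩]
    exact lp.memℓp _
  · refine lp.ext ?_
    rw [← h v, hvw]
    rfl

theorem isPositiveOperator_H0 : IsPositiveOperator H0 := by
  intro u hu
  rw [inner_eq_integral_of_isSpectralTransform isSpectralTransform_laguerreTransform,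
    Complex.ofReal_im, Complex.ofReal_re]
  refine ⟨rfl, ?_⟩
  set f := laguerreTransform (u : ℓ2) with hf
  have hi : Integrable (fun x => x * ‖f x‖ ^ 2) expMeasure := by
    refine (((mem_domain_H0_iff u).1 u.2).norm.integrable_mul (Lp.memLp f).norm).congr ?_
    filter_upwards [ae_expMeasure_pos] with x hx
    simp only [Pi.mul_apply, norm_mul, Complex.norm_real, Real.norm_eq_abs, abs_of_pos hx, hf]
    ring
  have h0 : 0 ≤ᵐ[expMeasure] fun x => x * ‖f x‖ ^ 2 := by
    filter_upwards [ae_expMeasure_pos] with x hx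
    exact mul_nonneg hx.le (by positivity)
  refine lt_of_le_of_ne (integral_nonneg_of_ae h0) fun h => hu ?_
  -- Strictness: `ρ` does not charge `x ≤ 0`, so a vanishing integral forces the transform of `u` to
  -- vanish.
  have h1 := (integral_eq_zero_iff_of_nonneg_ae h0 hi).1 h.symm
  have h2 : f = 0 := by
    refine Lp.ext ?_
    filter_upwards [h1, ae_expMeasure_pos, Lp.coeFn_zero ℂ 2 expMeasure] with x hx hpos hz
    rw [hz]
    simpa [hpos.ne'] using hx
  rw [hf, map_eq_zero_iff _ laguerreTransform.injective] at h2
  exact Subtype.ext h2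

/-! ### The Weyl function and the spectrum -/

theorem exists_norm_inv_sub_le {z : ℂ} (hz : z ∉ Complex.ofReal '' Set.Ici (0 : ℝ)) :
    ∃ C : ℝ, ∀ x : ℝ, 0 ≤ x → ‖((x : ℂ) - z)⁻¹‖ ≤ C := by
  have hc : IsClosed (Complex.ofReal '' Set.Ici (0 : ℝ)) :=
    Complex.isometry_ofReal.isClosedEmbedding.isClosedMap _ isClosed_Ici
  have hne : (Complex.ofReal '' Set.Ici (0 : ℝ)).Nonempty := ⟨_, 0, by simp, rfl⟩
  have hd := (hc.notMem_iff_infDist_pos hne).1 hz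
  refine ⟨(Metric.infDist z (Complex.ofReal '' Set.Ici (0 : ℝ)))⁻¹, fun x hx => ?_⟩
  rw [norm_inv]
  refine inv_anti₀ hd ?_
  rw [← dist_eq_norm, dist_comm]
  exact Metric.infDist_le_dist_of_mem ⟨x, hx, rfl⟩

theorem aestronglyMeasurable_inv_sub (z : ℂ) (ρ : Measure ℝ) :
    AEStronglyMeasurable (fun x : ℝ => ((x : ℂ) - z)⁻¹) ρ :=
  (by fun_prop : Measurable fun x : ℝ => ((x : ℂ) - z)⁻¹).aestronglyMeasurable

theorem exists_isResolventAt_H0 {z : ℂ} (hz : z ∉ Complex.ofReal '' Set.Ici (0 : ℝ)) :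
    ∃ R : ℓ2 →L[ℂ] ℓ2, IsResolventAt H0 z R ∧
      inner ℂ delta0 (R delta0) = ∫ x : ℝ, ((x : ℂ) - z)⁻¹ ∂expMeasure := by
  obtain ⟨C, hC⟩ := exists_norm_inv_sub_le hz
  have hC' : ∀ᵐ x : ℝ ∂expMeasure, ‖((x : ℂ) - z)⁻¹‖ ≤ C := by
    filter_upwards [ae_expMeasure_pos] with x hx
    exact hC x hx.le
  have hne : ∀ᵐ x : ℝ ∂expMeasure, (x : ℂ) ≠ z := by
    filter_upwards [ae_expMeasure_pos] with x hx h
    exact hz ⟨x, hx.le, h⟩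
  have hm := aestronglyMeasurable_inv_sub z expMeasure
  refine ⟨_, isResolventAt_conjCLM_mulCLM isSpectralTransform_laguerreTransform hne hm hC', ?_⟩
  rw [← laguerreTransform.inner_map_map, conjCLM_apply, LinearIsometryEquiv.apply_symm_apply,
    L2.inner_def]
  refine integral_congr_ae ?_
  filter_upwards [laguerreTransform_delta0, coeFn_mulCLM hm hC' (laguerreTransform delta0)]
    with x h1 h2
  rw [h2, h1]
  simp

theorem exp_smul_inv_sub (z : ℂ) (x : ℝ) :
    Real.exp (-x) • ((x : ℂ) - z)⁻¹ = Complex.exp (-(x : ℂ)) / ((x : ℂ) - z) := by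
  rw [Complex.real_smul, div_eq_mul_inv]
  push_cast
  rfl

theorem integrableOn_exp_div_sub {z : ℂ} (hz : z ∉ Complex.ofReal '' Set.Ici (0 : ℝ)) :
    IntegrableOn (fun x : ℝ => Complex.exp (-(x : ℂ)) / ((x : ℂ) - z)) (Set.Ioi (0 : ℝ)) := by
  obtain ⟨C, hC⟩ := exists_norm_inv_sub_le hz
  simp only [← exp_smul_inv_sub]
  rw [← integrable_expMeasure_iff]
  refine (integrable_const C).mono' (aestronglyMeasurable_inv_sub z _) ?_
  filter_upwards [ae_expMeasure_pos] with x hx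
  exact hC x hx.le

theorem weylFunction_eq_integral {z : ℂ} (hz : z ∉ Complex.ofReal '' Set.Ici (0 : ℝ)) :
    weylFunction z = ∫ x in Set.Ioi (0 : ℝ), Complex.exp (-(x : ℂ)) / ((x : ℂ) - z) := by
  obtain ⟨R, hR, h⟩ := exists_isResolventAt_H0 hz
  rw [weylFunction, hR.resolvent_eq, h, integral_expMeasure]
  simp only [exp_smul_inv_sub]

/-- On the path `w = x - z` the prefactor `e^{-z}` cancels against `e^{-w} = e^{z} e^{-x}`, so the
integrands agree pointwise. -/
theorem exp_mul_expIntegralE1 (z : ℂ) :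
    Complex.exp (-z) * expIntegralE1 (-z) =
      ∫ x in Set.Ioi (0 : ℝ), Complex.exp (-(x : ℂ)) / ((x : ℂ) - z) := by
  rw [expIntegralE1, ← integral_const_mul]
  congr 1
  funext x
  rw [← mul_div_assoc, ← Complex.exp_add]
  congr 2 <;> ring

theorem expMeasure_Ioo_ne_zero {t ε : ℝ} (ht : 0 ≤ t) (hε : 0 < ε) :
    expMeasure (Set.Ioo t (t + ε)) ≠ 0 := by
  intro h
  rw [expMeasure_eq] at h
  have h1 : volume.restrict (Set.Ioi (0 : ℝ)) (Set.Ioo t (t + ε)) = 0 :=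
    withDensity_absolutelyContinuous' (by fun_prop)
      (ae_of_all _ fun x => by simp [Real.exp_pos]) h
  rw [Measure.restrict_apply measurableSet_Ioo,
    Set.inter_eq_self_of_subset_left (t := Set.Ioi (0 : ℝ))
      fun x hx => lt_of_le_of_lt ht hx.1] at h1
  simp at h1
  linarith

theorem spectrum_H0 : spectrum H0 = Complex.ofReal '' Set.Ici (0 : ℝ) := by
  refine Set.Subset.antisymm (fun z hz => ?_) ?_
  · by_contra h
    obtain ⟨R, hR, -⟩ := exists_isResolventAt_H0 h
    exact hz ⟨R, hR⟩
  · rintro _ ⟨t, ht, rfl⟩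
    exact mem_spectrum_of_isSpectralTransform isSpectralTransform_laguerreTransform
      fun ε hε => expMeasure_Ioo_ne_zero ht hε

end LaguerreJacobi

end

theorem theorem2p1 :
    -- (i) the operator is self-adjoint and positive
    (IsSelfAdjoint LaguerreJacobi.H0 ∧ LaguerreJacobi.IsPositiveOperator LaguerreJacobi.H0) ∧
    -- (ii) the Weyl function
    (∀ z : ℂ, z ∉ Complex.ofReal '' Set.Ici (0 : ℝ) →
      LaguerreJacobi.weylFunction z = Complex.exp (-z) * LaguerreJacobi.expIntegralE1 (-z) ∧
      MeasureTheory.IntegrableOn (fun x : ℝ => Complex.exp (-(x : ℂ)) / ((x : ℂ) - z))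
        (Set.Ioi (0 : ℝ)) ∧
      LaguerreJacobi.weylFunction z =
        ∫ x in Set.Ioi (0 : ℝ), Complex.exp (-(x : ℂ)) / ((x : ℂ) - z)) ∧
    -- (ii) unitary equivalence with multiplication in the weighted space
    (∃ U : LaguerreJacobi.ℓ2 ≃ₗᵢ[ℂ] MeasureTheory.Lp ℂ 2 LaguerreJacobi.expMeasure,
      LaguerreJacobi.IsSpectralTransform LaguerreJacobi.H0 LaguerreJacobi.delta0
        LaguerreJacobi.expMeasure U) ∧
    -- (ii) the spectral measure, and (iii) pure absolute continuity
    (∃ E : LaguerreJacobi.ProjectionValuedMeasure LaguerreJacobi.ℓ2,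
      E.IsResolutionOf LaguerreJacobi.H0 ∧
      E.scalarMeasure LaguerreJacobi.delta0 = LaguerreJacobi.expMeasure ∧
      ∀ u : LaguerreJacobi.ℓ2,
        (E.scalarMeasure u).AbsolutelyContinuous MeasureTheory.volume) ∧
    -- (iii) the spectrum
    LaguerreJacobi.spectrum LaguerreJacobi.H0 = Complex.ofReal '' Set.Ici (0 : ℝ) := by
  open LaguerreJacobi in
  refine ⟨⟨isSelfAdjoint_H0, isPositiveOperator_H0⟩, fun z hz => ⟨?_, ?_, ?_⟩,
    ⟨laguerreTransform, isSpectralTransform_laguerreTransform⟩,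
    ⟨spectralResolution laguerreTransform,
      isResolutionOf_spectralResolution isSpectralTransform_laguerreTransform,
      scalarMeasure_cyclic isSpectralTransform_laguerreTransform, fun u => ?_⟩, spectrum_H0⟩
  · rw [weylFunction_eq_integral hz, exp_mul_expIntegralE1]
  · exact integrableOn_exp_div_sub hz
  · exact weylFunction_eq_integral hz
  · rw [scalarMeasure_spectralResolution]
    exact (withDensity_absolutelyContinuous _ _).trans expMeasure_absolutelyContinuous
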